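/- A turn-based Rabin game $G=(S,S_s,S_e,I,A,T,W)$ consists of a finite set $S$ of states, a set $S_s\subseteq S$ of system states, with $S_e=S\setminus S_s$ the environment states, a set $I\subseteq S$ of initial states, a finite set $A$ of actions with a nonempty set $A^G(s)\subseteq A$ of available actions at each state $s$, a transition function $T$ assigning to each $(s,a)\in S\times A$ a probability distribution on $S$, and finitely many Rabin pairs $W=\{(E_1,F_1),\dots,(E_d,F_d)\}$ with $E_i,F_i\subseteq S$ and $E_i\cap F_i=\emptyset$. A (randomized) strategy for the system consists of a countable set $M$ of memory states, an initial memory state $m^0\in M$, a map $\sigma$ assigning to each $(s,m)\in S_s\times M$ a probability distribution on $A$ that gives positive probability only to actions in $A^G(s)$, and a memory update function $\rho:S\times M\to M$. At time $n$, in state $s_n$ with memory $m_n$, the action $a_n$ is drawn from $\sigma(s_n,m_n)$ if $s_n\in S_s$, the next state $s_{n+1}$ is drawn from $T(s_n,a_n)$, and the memory becomes $m_{n+1}=\rho(s_n,m_n)$, with $m_0=m^0$. Environment strategies are defined in the same way with $S_e$ in place of $S_s$. A strategy is memoryless if $M$ is a singleton; for a memoryless system strategy $\sigma$ and $s\in S_s$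 write $A_\sigma(s)=\{a\in A^G(s)\mid\sigma(s)(a)>0\}$. An infinite run $\pi=(s_0,a_0),(s_1,a_1),\dots$ is winning for the system if for some $i$ the set $\mathrm{Inf}(\pi)$ of states occurring infinitely often in $\pi$ satisfies $\mathrm{Inf}(\pi)\cap F_i\neq\emptyset$ and $\mathrm{Inf}(\pi)\cap E_i=\emptyset$. A system strategy $\sigma_s$ is almost-sure winning if for every environment strategy $\sigma_e$ and every initial state $s\in I$, the run from $s$ generated by $(\sigma_s,\sigma_e)$ is winning with probability $1$ (equivalently, with probability $1$ conditionally on being feasible for $(\sigma_s,\sigma_e)$, since the run is feasible with probability $1$). Lemma. Let $\sigma_s^1$ and $\sigma_s^2$ be two memoryless strategies for the system in a turn-based Rabin game $G$. If $A_{\sigma_s^1}(s)=A_{\sigma_s^2}(s)$ for all $s\in S_s$, then $\sigma_s^1$ is almost-sure winning for the system if and only if $\sigma_s^2$ is almost-sure winning for the system. -/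

import Mathlib

open MeasureTheory ProbabilityTheory Filter

/-- A turn-based (stochastic) Rabin game with state space `S` and action set `A`, both of which are
assumed finite wherever probabilities are considered. The environment states are the complement of
the system states. -/
structure RabinGame (S : Type*) (A : Type*) where
  /-- the states at which the system chooses the action -/
  sys : Set S
  /-- the initial states -/
  start : Set S
  /-- the available actions at each state -/
  avail : S → Set A
  avail_nonempty : ∀ s, (avail s).Nonempty
  /-- the probabilistic transition function -/
  trans : S → A → PMF S
  /-- the number of Rabin pairs -/
  d : ℕ
  /-- the Rabin pairs are `(E i, F i)` -/
  E : Fin d → Set S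
  F : Fin d → Set S
  disjoint_pairs : ∀ i, Disjoint (E i) (F i)

/-- A state together with the action chosen at it. -/
@[ext]
structure Step (S : Type*) (A : Type*) where
  state : S
  action : A

namespace Step

variable {S A : Type*}

instance : MeasurableSpace (Step S A) := ⊤

instance : DiscreteMeasurableSpace (Step S A) := ⟨fun _ => trivial⟩

instance [Finite S] [Finite A] : Finite (Step S A) :=
  Finite.of_injective (fun x : Step S A => (x.state, x.action)) fun _ _ h =>
    Step.ext (congrArg Prod.fst h) (congrArg Prod.snd h)

end Step

namespace RabinGame

variable {S A : Type*}

/-- The states at which the environment chooses the action. -/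
def env (G : RabinGame S A) : Set S := G.sysᶜ

/-- A randomized strategy for the player who owns the states in `P`: a countable set of memory
states, an initial memory state, a distribution over (available) actions for every state of the
player and every memory state, and a memory update function. -/
structure Strategy (G : RabinGame S A) (P : Set S) where
  Mem : Type
  countable_mem : Countable Mem
  mem₀ : Mem
  choose : P → Mem → PMF A
  choose_avail : ∀ (s : P) (m : Mem) (a : A), 0 < choose s m a → a ∈ G.avail s
  update : S → Mem → Mem

/-- System strategies. -/
abbrev SysStrategy (G : RabinGame S A) := G.Strategy G.sys

/-- Environment strategies. -/
abbrev EnvStrategy (G : RabinGame S A) := G.Strategy G.env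

namespace Strategy

variable {G : RabinGame S A} {P : Set S}

/-- A strategy is memoryless if its set of memory states is a singleton
(it is nonempty in any case). -/
def IsMemoryless (σ : G.Strategy P) : Prop := Subsingleton σ.Mem

/-- The set of actions allowed by a strategy at a state with a given memory state. -/
def allowed (σ : G.Strategy P) (s : P) (m : σ.Mem) : Set A :=
  {a | 0 < σ.choose s m a ∧ a ∈ G.avail s}

/-- The memory state at time `n` along a sequence of states; it depends only on the states
at the times before `n`. -/
def memAt (σ : G.Strategy P) (s : ℕ → S) : ℕ → σ.Mem
  | 0 => σ.mem₀
  | n + 1 => σ.update (s n) (σ.memAt s n)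

end Strategy

variable (G : RabinGame S A)

open Classical in
/-- The distribution of the action chosen at state `s` when the memory states of the system and of
the environment are `m` and `m'`. -/
noncomputable def chooseAction (σ : G.SysStrategy) (τ : G.EnvStrategy) (s : S)
    (m : σ.Mem) (m' : τ.Mem) : PMF A :=
  if h : s ∈ G.sys then σ.choose ⟨s, h⟩ m else τ.choose ⟨s, h⟩ m'

/-- The distribution of the first state-action pair of a play from `s₀`. -/
noncomputable def firstStep (σ : G.SysStrategy) (τ : G.EnvStrategy) (s₀ : S) :
    PMF (Step S A) :=
  (G.chooseAction σ τ s₀ σ.mem₀ τ.mem₀).map fun a => ⟨s₀, a⟩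

/-- The sequence of states of a finite history, continued constantly. -/
def historyStates {n : ℕ} (h : Finset.Iic n → Step S A) : ℕ → S :=
  fun i => (h ⟨min i n, Finset.mem_Iic.2 (min_le_right i n)⟩).state

/-- The distribution of the next state-action pair of a play, given the history
`(s 0, a 0), …, (s n, a n)`: the next state is drawn from the transition function, and then the
next action from the strategy of the owner of that state, at the memory state reached by reading
`s 0, …, s n`. -/
noncomputable def nextStep (σ : G.SysStrategy) (τ : G.EnvStrategy) {n : ℕ}
    (h : Finset.Iic n → Step S A) : PMF (Step S A) :=
  let last := h ⟨n, Finset.mem_Iic.2 le_rfl⟩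
  (G.trans last.state last.action).bind fun s' =>
    (G.chooseAction σ τ s' (σ.memAt (historyStates h) (n + 1))
      (τ.memAt (historyStates h) (n + 1))).map fun a' => ⟨s', a'⟩

/-- `nextStep` as a Markov kernel from histories to state-action pairs. -/
noncomputable def nextKernel [Finite S] [Finite A] (σ : G.SysStrategy) (τ : G.EnvStrategy)
    (n : ℕ) : Kernel (Finset.Iic n → Step S A) (Step S A) where
  toFun h := (G.nextStep σ τ h).toMeasure
  measurable' := Measurable.of_discrete

instance [Finite S] [Finite A] (σ : G.SysStrategy) (τ : G.EnvStrategy) (n : ℕ) :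
    IsMarkovKernel (G.nextKernel σ τ n) :=
  ⟨fun h => PMF.toMeasure.isProbabilityMeasure (G.nextStep σ τ h)⟩

/-- The law of the play (as an infinite sequence of state-action pairs) that starts at `s₀` and
follows the given pair of strategies. -/
noncomputable def playMeasure [Finite S] [Finite A] (σ : G.SysStrategy) (τ : G.EnvStrategy)
    (s₀ : S) : Measure (ℕ → Step S A) :=
  Kernel.trajMeasure (X := fun _ => Step S A) (G.firstStep σ τ s₀).toMeasure (G.nextKernel σ τ)

/-- `π` is a run of the game. -/
def IsRun (π : ℕ → Step S A) : Prop :=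
  ∀ i, (π i).action ∈ G.avail (π i).state ∧
    0 < G.trans (π i).state (π i).action (π (i + 1)).state

/-- The set of runs from `s₀` that are feasible for the given pair of strategies. -/
def feasibleRuns (s₀ : S) (σ : G.SysStrategy) (τ : G.EnvStrategy) : Set (ℕ → Step S A) :=
  {π | G.IsRun π ∧ (π 0).state = s₀ ∧
    (∀ i, ∀ h : (π i).state ∈ G.sys,
      0 < σ.choose ⟨(π i).state, h⟩ (σ.memAt (fun j => (π j).state) i) (π i).action) ∧
    (∀ i, ∀ h : (π i).state ∈ G.env,
      0 < τ.choose ⟨(π i).state, h⟩ (τ.memAt (fun j => (π j).state) i) (π i).action)}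

/-- The set of states visited infinitely often. -/
def infStates (π : ℕ → Step S A) : Set S := {s | ∃ᶠ n in atTop, (π n).state = s}

/-- The set of sequences that are winning for the system, by the Rabin condition. -/
def winningRuns : Set (ℕ → Step S A) :=
  {π | ∃ i, (infStates π ∩ G.F i).Nonempty ∧ infStates π ∩ G.E i = ∅}

/-- A system strategy is almost-sure winning if, from every initial state and against every
environment strategy, a feasible run is winning with probability one. -/
def AlmostSureWinning [Finite S] [Finite A] (σ : G.SysStrategy) : Prop :=
  ∀ τ : G.EnvStrategy, ∀ s₀ ∈ G.start,
    ProbabilityTheory.cond (G.playMeasure σ τ s₀) (G.feasibleRuns s₀ σ τ) G.winningRuns = 1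

end RabinGame

/-! For a memoryless system strategy, almost-sure winning is a property of the support alone: it
fails exactly when some single run is an `IsLosingWitness`, a combinatorial condition that mentions
only the allowed actions.

If no witness exists, the conditional Borel–Cantelli lemma (`ae_frequently_mem_iff`) shows that
almost every play, against any environment strategy, satisfies every clause of a witness except
possibly losing; hence it wins. Conversely, a witness yields a memoryless environment strategy that
can follow the witness into its recurrent states and then never leaves them. The entering prefix has
positive probability (`playMeasure_prefix_ne_zero`), and after it the play almost surely has the
same infinitely visited states as the witness (`IsLosingWitness.ae_infStates_eq`), so it loses. -/

theorem tendsto_sum_range_atTop_of_frequently_le {f : ℕ → ℝ} {c : ℝ} (hf : ∀ n, 0 ≤ f n)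
    (hc : 0 < c) (h : ∃ᶠ n in atTop, c ≤ f n) :
    Tendsto (fun n => ∑ k ∈ Finset.range n, f k) atTop atTop := by
  rw [← not_summable_iff_tendsto_nat_atTop_of_nonneg hf]
  intro hs
  refine h ?_
  filter_upwards [hs.tendsto_atTop_zero.eventually_lt_const hc] with n hn using not_le.2 hn

theorem PMF.exists_support_eq {α : Type*} [Finite α] {D : Set α} (hD : D.Nonempty) :
    ∃ p : PMF α, p.support = D := by
  have h : D.toFinite.toFinset.Nonempty := D.toFinite.toFinset_nonempty.2 hD
  refine ⟨PMF.uniformOfFinset D.toFinite.toFinset h, ?_⟩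
  ext
  rw [PMF.mem_support_uniformOfFinset_iff, Set.Finite.mem_toFinset]

namespace RabinGame

open Preorder

variable {S A : Type*} (G : RabinGame S A)

theorem Strategy.memAt_congr {G : RabinGame S A} {P : Set S} (σ : G.Strategy P) {s t : ℕ → S} :
    ∀ n, (∀ i < n, s i = t i) → σ.memAt s n = σ.memAt t n
  | 0, _ => rfl
  | n + 1, h => by
    rw [Strategy.memAt, Strategy.memAt, h n n.lt_succ_self,
      σ.memAt_congr n fun i hi => h i (hi.trans n.lt_succ_self)]

/-- Memory at time `n + 1` reads only the states up to time `n`, so the artificial constant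
continuation of the history plays no role. -/
theorem Strategy.memAt_historyStates {G : RabinGame S A} {P : Set S} (σ : G.Strategy P)
    (π : ℕ → Step S A) (n : ℕ) :
    σ.memAt (historyStates (frestrictLe (π := fun _ => Step S A) n π)) (n + 1) =
      σ.memAt (fun j => (π j).state) (n + 1) := by
  refine σ.memAt_congr _ fun i hi => ?_
  simp [historyStates, Nat.le_of_lt_succ hi]

theorem map_state_apply (p : PMF A) (s : S) (a : A) :
    (p.map fun a => (⟨s, a⟩ : Step S A)) ⟨s, a⟩ = p a := by
  rw [PMF.map_apply, tsum_eq_single a]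
  · simp
  · intro b hb
    simp [Ne.symm hb]

theorem map_state_apply_of_ne (p : PMF A) {s t : S} (h : s ≠ t) (a : A) :
    (p.map fun a => (⟨t, a⟩ : Step S A)) ⟨s, a⟩ = 0 := by
  rw [PMF.map_apply, ENNReal.tsum_eq_zero]
  simp [h]

/-! ### The law of a play: one-step distributions, recurrence, feasibility, prefixes -/

section Play

variable (σ : G.SysStrategy) (τ : G.EnvStrategy)

theorem nextStep_apply {n : ℕ} (h : Finset.Iic n → Step S A) (x : Step S A) :
    G.nextStep σ τ h x =
      G.trans (h ⟨n, Finset.mem_Iic.2 le_rfl⟩).state (h ⟨n, Finset.mem_Iic.2 le_rfl⟩).action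
        x.state * G.chooseAction σ τ x.state (σ.memAt (historyStates h) (n + 1))
          (τ.memAt (historyStates h) (n + 1)) x.action := by
  rw [nextStep, PMF.bind_apply, tsum_eq_single x.state]
  · rw [map_state_apply]
  · intro t ht
    rw [map_state_apply_of_ne _ ht.symm, mul_zero]

theorem nextStep_map_state {n : ℕ} (h : Finset.Iic n → Step S A) :
    (G.nextStep σ τ h).map Step.state =
      G.trans (h ⟨n, Finset.mem_Iic.2 le_rfl⟩).state
        (h ⟨n, Finset.mem_Iic.2 le_rfl⟩).action := by
  rw [nextStep, PMF.map_bind]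
  simp only [PMF.map_comp, Function.comp_def]
  exact (congrArg _ (funext fun s => PMF.map_const _ s)).trans (PMF.bind_pure _)

theorem nextStep_toMeasure_state {n : ℕ} (h : Finset.Iic n → Step S A) (s : S) :
    (G.nextStep σ τ h).toMeasure {x | x.state = s} =
      G.trans (h ⟨n, Finset.mem_Iic.2 le_rfl⟩).state
        (h ⟨n, Finset.mem_Iic.2 le_rfl⟩).action s := by
  rw [← G.nextStep_map_state σ τ h, PMF.toMeasure_apply_eq_toOuterMeasure_apply,
    ← PMF.toOuterMeasure_apply_singleton _ s, PMF.toOuterMeasure_map_apply]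
  · rfl
  · exact MeasurableSet.of_discrete

variable [Finite S] [Finite A]

instance (s₀ : S) : IsProbabilityMeasure (G.firstStep σ τ s₀).toMeasure :=
  PMF.toMeasure.isProbabilityMeasure _

instance (s₀ : S) : IsProbabilityMeasure (G.playMeasure σ τ s₀) := by
  unfold playMeasure; infer_instance

theorem map_frestrictLe_compProd_nextKernel (s₀ : S) (n : ℕ) :
    (G.playMeasure σ τ s₀).map (frestrictLe n) ⊗ₘ G.nextKernel σ τ n =
      (G.playMeasure σ τ s₀).map (fun x => (frestrictLe n x, x (n + 1))) :=
  Kernel.map_frestrictLe_trajMeasure_compProd_eq_map_trajMeasure (X := fun _ => Step S A)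

theorem map_eval_zero_playMeasure (s₀ : S) :
    (G.playMeasure σ τ s₀).map (fun x => x 0) = (G.firstStep σ τ s₀).toMeasure := by
  have h : (G.playMeasure σ τ s₀).map (frestrictLe 0) =
      (G.firstStep σ τ s₀).toMeasure.map
        (MeasurableEquiv.piUnique fun _ : Finset.Iic 0 => Step S A).symm := by
    rw [playMeasure, Kernel.trajMeasure, Measure.map_comp _ _ (by fun_prop),
      Kernel.traj_map_frestrictLe, Kernel.partialTraj_self, Measure.id_comp]
  have h' := congrArg (Measure.map fun h : Finset.Iic 0 → Step S A => h ⟨0, by simp⟩) h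
  rw [Measure.map_map (by fun_prop) (by fun_prop), Measure.map_map (by fun_prop) (by fun_prop)] at h'
  refine h'.trans ?_
  convert! Measure.map_id

/-- Lévy's conditional Borel–Cantelli lemma for the filtration of histories, where the conditional
probabilities are given by `nextStep`. -/
theorem ae_frequently_mem_iff (s₀ : S) (U : Set (Step S A)) :
    ∀ᵐ π ∂G.playMeasure σ τ s₀, (∃ᶠ n in atTop, π n ∈ U) ↔
      Tendsto (fun n => ∑ k ∈ Finset.range n,
        ((G.nextStep σ τ (frestrictLe (π := fun _ => Step S A) k π)).toMeasure).real U)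
        atTop atTop := by
  have hne : Nonempty (Step S A) := (G.firstStep σ τ s₀).support_nonempty.to_type
  have hU : ∀ n, MeasurableSet[Filtration.piLE (X := fun _ : ℕ => Step S A) n]
      ((fun π : ℕ → Step S A => π n) ⁻¹' U) := by
    intro n
    rw [Filtration.piLE_eq_comap_frestrictLe]
    exact ⟨{h | h ⟨n, by simp⟩ ∈ U}, .of_discrete, rfl⟩
  have key : ∀ n, (G.playMeasure σ τ s₀)[((fun π : ℕ → Step S A => π (n + 1)) ⁻¹' U).indicator
      (1 : (ℕ → Step S A) → ℝ) | Filtration.piLE (X := fun _ : ℕ => Step S A) n]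
      =ᵐ[G.playMeasure σ τ s₀] fun π =>
        ((G.nextStep σ τ (frestrictLe (π := fun _ => Step S A) n π)).toMeasure).real U := by
    intro n
    rw [Filtration.piLE_eq_comap_frestrictLe]
    have h1 := condDistrib_ae_eq_condExp (μ := G.playMeasure σ τ s₀)
      (X := frestrictLe (π := fun _ => Step S A) n) (Y := fun π => π (n + 1)) (s := U)
      (mβ := MeasurableSpace.pi) (measurable_frestrictLe (X := fun _ => Step S A) n)
      (measurable_pi_apply _) .of_discrete
    have h2 := ae_of_ae_map (measurable_frestrictLe (X := fun _ => Step S A) n).aemeasurable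
      (Kernel.condDistrib_trajMeasure (X := fun _ => Step S A) (κ := G.nextKernel σ τ)
      (μ₀ := (G.firstStep σ τ s₀).toMeasure) (a := n))
    refine h1.symm.trans ?_
    filter_upwards [h2] with π hπ
    rw [show (condDistrib (fun π : ℕ → Step S A => π (n + 1))
      (frestrictLe (π := fun _ => Step S A) n) (G.playMeasure σ τ s₀)) (frestrictLe n π) = _
      from hπ]
    rfl
  filter_upwards [ae_mem_limsup_atTop_iff (G.playMeasure σ τ s₀) hU, ae_all_iff.2 key]
    with π h1 h2
  rw [mem_limsup_iff_frequently_mem] at h1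
  simp only [h2] at h1
  exact h1

/-- Each occurrence of the step contributes the same positive amount to the sum of conditional
probabilities of moving to `s'`, so the sum diverges. -/
theorem ae_mem_infStates_of_trans_pos (s₀ : S) :
    ∀ᵐ π ∂G.playMeasure σ τ s₀, ∀ s a s', (∃ᶠ n in atTop, π n = ⟨s, a⟩) →
      0 < G.trans s a s' → s' ∈ infStates π := by
  simp only [ae_all_iff]
  intro s a s'
  filter_upwards [G.ae_frequently_mem_iff σ τ s₀ {x | x.state = s'}] with π hπ hio hpos
  refine hπ.2 (tendsto_sum_range_atTop_of_frequently_le (c := (G.trans s a s').toReal)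
    (fun _ => measureReal_nonneg)
    (ENNReal.toReal_pos hpos.ne' (PMF.apply_ne_top _ _)) (hio.mono fun n hn => ?_))
  rw [measureReal_def, nextStep_toMeasure_state]
  simp [hn]

/-- Borel–Cantelli is used in both directions: infinitely many visits to `s` make the conditional
probabilities of `s` sum to infinity, and those of the step are at least `c` times as large. The
bound must be uniform in the memory states, which may be infinite in number. -/
theorem ae_frequently_eq_of_le_chooseAction (s₀ s : S) (a : A) {c : ENNReal} (hc : c ≠ 0)
    (h : ∀ m m', c ≤ G.chooseAction σ τ s m m' a) :
    ∀ᵐ π ∂G.playMeasure σ τ s₀, s ∈ infStates π → ∃ᶠ n in atTop, π n = ⟨s, a⟩ := by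
  have hctop : c ≠ ⊤ := ne_top_of_le_ne_top (PMF.apply_ne_top _ _) (h σ.mem₀ τ.mem₀)
  filter_upwards [G.ae_frequently_mem_iff σ τ s₀ {x | x.state = s},
    G.ae_frequently_mem_iff σ τ s₀ {⟨s, a⟩}] with π h1 h2 hs
  refine h2.2 (tendsto_atTop_mono (fun n => ?_)
    ((h1.1 hs).const_mul_atTop (ENNReal.toReal_pos hc hctop)))
  rw [Finset.mul_sum]
  refine Finset.sum_le_sum fun k _ => ?_
  rw [measureReal_def, measureReal_def, nextStep_toMeasure_state, ← ENNReal.toReal_mul,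
    PMF.toMeasure_apply_singleton _ _ .of_discrete, nextStep_apply, mul_comm]
  refine ENNReal.toReal_mono (ENNReal.mul_ne_top (PMF.apply_ne_top _ _) (PMF.apply_ne_top _ _)) ?_
  gcongr
  exact h _ _

theorem ae_nextStep_pos (s₀ : S) (n : ℕ) :
    ∀ᵐ π ∂G.playMeasure σ τ s₀,
      G.nextStep σ τ (frestrictLe (π := fun _ => Step S A) n π) (π (n + 1)) ≠ 0 := by
  have h : ∀ᵐ x ∂((G.playMeasure σ τ s₀).map (frestrictLe n) ⊗ₘ G.nextKernel σ τ n),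
      G.nextStep σ τ x.1 x.2 ≠ 0 := by
    refine Measure.ae_compProd_of_ae_ae .of_discrete (ae_of_all _ fun x => ?_)
    change ∀ᵐ y ∂(G.nextStep σ τ x).toMeasure, _
    rw [ae_iff, PMF.toMeasure_apply_eq_zero_iff _ .of_discrete, Set.disjoint_left]
    intro y hy hy'
    exact hy' hy
  rw [map_frestrictLe_compProd_nextKernel] at h
  exact ae_of_ae_map (f := fun π => (frestrictLe (π := fun _ => Step S A) n π, π (n + 1)))
    (by fun_prop) h

theorem ae_eval_zero (s₀ : S) :
    ∀ᵐ π ∂G.playMeasure σ τ s₀, G.firstStep σ τ s₀ (π 0) ≠ 0 := by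
  have h : ∀ᵐ x ∂(G.firstStep σ τ s₀).toMeasure, G.firstStep σ τ s₀ x ≠ 0 := by
    rw [ae_iff, PMF.toMeasure_apply_eq_zero_iff _ .of_discrete, Set.disjoint_left]
    intro y hy hy'
    exact hy' hy
  rw [← map_eval_zero_playMeasure] at h
  exact ae_of_ae_map (f := fun π : ℕ → Step S A => π 0)
    (measurable_pi_apply (X := fun _ => Step S A) 0).aemeasurable h

theorem ae_chooseAction_ne_zero (s₀ : S) :
    ∀ᵐ π ∂G.playMeasure σ τ s₀, (π 0).state = s₀ ∧
      (∀ n, G.trans (π n).state (π n).action (π (n + 1)).state ≠ 0) ∧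
      ∀ n, G.chooseAction σ τ (π n).state (σ.memAt (fun j => (π j).state) n)
        (τ.memAt (fun j => (π j).state) n) (π n).action ≠ 0 := by
  filter_upwards [G.ae_eval_zero σ τ s₀, ae_all_iff.2 (G.ae_nextStep_pos σ τ s₀)] with π h0 h
  simp only [nextStep_apply, Strategy.memAt_historyStates] at h
  have hs : (π 0).state = s₀ := by
    by_contra hne
    exact h0 (map_state_apply_of_ne _ hne (π 0).action)
  refine ⟨hs, fun n => left_ne_zero_of_mul (h n), fun n => ?_⟩
  cases n with
  | zero =>
    subst hs
    rwa [firstStep, map_state_apply _ _ (π 0).action] at h0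
  | succ n => exact right_ne_zero_of_mul (h n)

theorem ae_mem_feasibleRuns (s₀ : S) :
    ∀ᵐ π ∂G.playMeasure σ τ s₀, π ∈ G.feasibleRuns s₀ σ τ := by
  filter_upwards [G.ae_chooseAction_ne_zero σ τ s₀] with π ⟨h0, ht, hc⟩
  have hsys : ∀ i, ∀ h : (π i).state ∈ G.sys,
      0 < σ.choose ⟨(π i).state, h⟩ (σ.memAt (fun j => (π j).state) i) (π i).action := by
    intro i h
    simpa [chooseAction, h, pos_iff_ne_zero] using hc i
  have henv : ∀ i, ∀ h : (π i).state ∈ G.env,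
      0 < τ.choose ⟨(π i).state, h⟩ (τ.memAt (fun j => (π j).state) i) (π i).action := by
    intro i h
    have h' : (π i).state ∉ G.sys := h
    simpa [chooseAction, h', pos_iff_ne_zero] using hc i
  refine ⟨fun i => ⟨?_, pos_iff_ne_zero.2 (ht i)⟩, h0, hsys, henv⟩
  by_cases h : (π i).state ∈ G.sys
  · exact σ.choose_avail _ _ _ (hsys i h)
  · exact τ.choose_avail _ _ _ (henv i h)

theorem cond_feasibleRuns (s₀ : S) :
    ProbabilityTheory.cond (G.playMeasure σ τ s₀) (G.feasibleRuns s₀ σ τ) =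
      G.playMeasure σ τ s₀ := by
  have h := G.ae_mem_feasibleRuns σ τ s₀
  have h1 : G.playMeasure σ τ s₀ (G.feasibleRuns s₀ σ τ) = 1 := by
    exact (measure_congr (eventuallyEq_univ.2 h)).trans measure_univ
  rw [ProbabilityTheory.cond, h1, Measure.restrict_eq_self_of_ae_mem h]
  simp

/-- By the chain rule, the probability of a prefix is a product of one-step probabilities. The
transition out of step `N` is not part of the prefix, hence the strict bound in `ht`. -/
theorem playMeasure_prefix_ne_zero {π : ℕ → Step S A} {N : ℕ}
    (ht : ∀ n < N, G.trans (π n).state (π n).action (π (n + 1)).state ≠ 0)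
    (hc : ∀ n ≤ N, G.chooseAction σ τ (π n).state (σ.memAt (fun j => (π j).state) n)
      (τ.memAt (fun j => (π j).state) n) (π n).action ≠ 0) :
    ∀ n ≤ N, G.playMeasure σ τ (π 0).state {ω | ∀ i ≤ n, ω i = π i} ≠ 0 := by
  intro n
  induction n with
  | zero =>
    intro _ h0
    have h1 : (G.playMeasure σ τ (π 0).state).map (fun x => x 0) {π 0} = 0 := by
      rw [Measure.map_apply (by fun_prop) .of_discrete, ← h0]
      congr 1
      ext ω
      simp
    rw [map_eval_zero_playMeasure, PMF.toMeasure_apply_singleton _ _ .of_discrete, firstStep,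
      map_state_apply _ _ (π 0).action] at h1
    exact hc 0 N.zero_le h1
  | succ n ih =>
    intro hn h0
    have hmap := G.map_frestrictLe_compProd_nextKernel σ τ (π 0).state n
    have hmap' := congrArg (fun μ => μ ({frestrictLe n π} ×ˢ {π (n + 1)})) hmap
    beta_reduce at hmap'
    rw [Measure.compProd_apply_prod .of_discrete .of_discrete, lintegral_singleton,
      Measure.map_apply (by fun_prop) .of_discrete, Measure.map_apply (by fun_prop) .of_discrete]
      at hmap'
    have hset : (fun x : ℕ → Step S A => (frestrictLe (π := fun _ => Step S A) n x, x (n + 1))) ⁻¹'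
        ({frestrictLe n π} ×ˢ {π (n + 1)}) = {ω | ∀ i ≤ n + 1, ω i = π i} := by
      ext ω
      simp only [Set.mem_preimage, Set.mem_prod, Set.mem_singleton_iff, Set.mem_ofPred_eq]
      constructor
      · rintro ⟨h1, h2⟩ i hi
        rcases Nat.le_succ_iff.1 hi with hi | rfl
        · exact congrFun h1 ⟨i, Finset.mem_Iic.2 hi⟩
        · exact h2
      · exact fun h => ⟨funext fun i => h i ((Finset.mem_Iic.1 i.2).trans n.le_succ), h _ le_rfl⟩
    have hset' : frestrictLe (π := fun _ => Step S A) n ⁻¹' {frestrictLe n π} =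
        {ω | ∀ i ≤ n, ω i = π i} := by
      ext ω
      exact ⟨fun h i hi => congrFun h ⟨i, Finset.mem_Iic.2 hi⟩,
        fun h => funext fun i => h i (Finset.mem_Iic.1 i.2)⟩
    rw [hset, hset', h0, mul_eq_zero] at hmap'
    refine hmap'.elim (fun h => ?_) (ih (n.le_succ.trans hn))
    change (G.nextStep σ τ _).toMeasure _ = 0 at h
    rw [PMF.toMeasure_apply_singleton _ _ .of_discrete, nextStep_apply, mul_eq_zero,
      Strategy.memAt_historyStates, Strategy.memAt_historyStates] at h
    exact h.elim (ht n hn) (hc _ hn)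

end Play

/-! ### Losing witnesses and recurrent states of sequences -/

/-- A losing run from an initial state that takes only the system actions in `act`, such that the
set of steps it takes infinitely often is closed under the moves of the system in `act` and of
the transition function. -/
structure IsLosingWitness (act : G.sys → Set A) (π : ℕ → Step S A) : Prop where
  isRun : G.IsRun π
  start : (π 0).state ∈ G.start
  mem_act : ∀ n, ∀ h : (π n).state ∈ G.sys, (π n).action ∈ act ⟨(π n).state, h⟩
  losing : π ∉ G.winningRuns
  trans_closed : ∀ s a s', (∃ᶠ n in atTop, π n = ⟨s, a⟩) → 0 < G.trans s a s' → s' ∈ infStates π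
  act_closed : ∀ s : G.sys, ∀ a ∈ act s, (s : S) ∈ infStates π → ∃ᶠ n in atTop, π n = ⟨s, a⟩

theorem eventually_frequently_eq {X : Type*} [Finite X] (π : ℕ → X) :
    ∀ᶠ n in atTop, ∃ᶠ k in atTop, π k = π n := by
  have h : ∀ x, ∀ᶠ n in atTop, π n = x → ∃ᶠ k in atTop, π k = x := by
    intro x
    by_cases hx : ∃ᶠ k in atTop, π k = x
    · exact .of_forall fun _ _ => hx
    · exact (not_frequently.1 hx).mono fun n hn h => absurd h hn
  filter_upwards [eventually_all.2 h] with n hn using hn _ rfl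

theorem mem_infStates_of_frequently {π : ℕ → Step S A} {x : Step S A}
    (h : ∃ᶠ n in atTop, π n = x) : x.state ∈ infStates π :=
  h.mono fun _ hn => congrArg Step.state hn

theorem exists_frequently_eq_of_mem_infStates [Finite S] [Finite A] {π : ℕ → Step S A} {s : S}
    (h : s ∈ infStates π) : ∃ a, ∃ᶠ n in atTop, π n = ⟨s, a⟩ := by
  obtain ⟨n, hn, hk⟩ := (Filter.Frequently.and_eventually h (eventually_frequently_eq π)).exists
  subst hn
  exact ⟨_, hk⟩

theorem infStates_nonempty [Finite S] (π : ℕ → Step S A) : (infStates π).Nonempty := by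
  obtain ⟨n, hn⟩ := (eventually_frequently_eq fun n => (π n).state).exists
  exact ⟨_, hn⟩

/-- If a sequence eventually stays in the infinitely visited states of `π` and its infinitely
visited states are closed under the recurrent steps of `π`, both visit the same states infinitely
often. -/
theorem infStates_eq_of_closed [Finite S] [Finite A] {π ω : ℕ → Step S A}
    (hsub : ∀ᶠ n in atTop, (ω n).state ∈ infStates π)
    (hclosed : ∀ n, (∃ᶠ k in atTop, π k = π n) → (π n).state ∈ infStates ω →
      (π (n + 1)).state ∈ infStates ω) : infStates ω = infStates π := by
  have hle : infStates ω ⊆ infStates π := by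
    intro s hs
    obtain ⟨n, hn, hn'⟩ := (Filter.Frequently.and_eventually hs hsub).exists
    exact hn ▸ hn'
  refine hle.antisymm fun t ht => ?_
  obtain ⟨s, hs⟩ := infStates_nonempty ω
  -- Beyond `N` every step of `π` is recurrent. Walking along `π` from a visit to `s` to a later
  -- visit to `t` carries membership in `infStates ω` from `s` to `t`.
  obtain ⟨N, hN⟩ := eventually_atTop.1 (eventually_frequently_eq π)
  obtain ⟨n, hn, rfl⟩ := frequently_atTop.1 (hle hs) N
  obtain ⟨m, hm, rfl⟩ := frequently_atTop.1 ht n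
  induction m, hm using Nat.le_induction with
  | base => exact hs
  | succ m hm ih =>
    exact hclosed m (hN m (hn.trans hm)) (ih (mem_infStates_of_frequently (hN m (hn.trans hm))))

/-! ### Almost-sure winning in terms of losing witnesses -/

variable {G}

theorem Strategy.IsMemoryless.eq_mem₀ {P : Set S} {σ : G.Strategy P} (h : σ.IsMemoryless)
    (m : σ.Mem) : m = σ.mem₀ :=
  have : Subsingleton σ.Mem := h
  Subsingleton.elim _ _

theorem Strategy.mem_allowed_iff {P : Set S} (σ : G.Strategy P) {s : P} {m : σ.Mem} {a : A} :
    a ∈ σ.allowed s m ↔ 0 < σ.choose s m a :=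
  ⟨And.left, fun h => ⟨h, σ.choose_avail _ _ _ h⟩⟩

theorem chooseAction_ne_zero_iff_of_mem (σ : G.SysStrategy) (τ : G.EnvStrategy) {s : S}
    (h : s ∈ G.sys) (m : σ.Mem) (m' : τ.Mem) (a : A) :
    G.chooseAction σ τ s m m' a ≠ 0 ↔ a ∈ σ.allowed ⟨s, h⟩ m := by
  simp [chooseAction, h, Strategy.mem_allowed_iff, pos_iff_ne_zero]

theorem chooseAction_ne_zero_iff_of_notMem (σ : G.SysStrategy) (τ : G.EnvStrategy) {s : S}
    (h : s ∉ G.sys) (m : σ.Mem) (m' : τ.Mem) (a : A) :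
    G.chooseAction σ τ s m m' a ≠ 0 ↔ a ∈ τ.allowed ⟨s, h⟩ m' := by
  simp [chooseAction, h, Strategy.mem_allowed_iff, pos_iff_ne_zero]

/-- There is a memoryless strategy whose allowed actions are a prescribed nonempty set of available
actions at each state. -/
theorem exists_memoryless_allowed_eq [Finite A] {P : Set S} (D : P → Set A)
    (hD : ∀ s, (D s).Nonempty) (hsub : ∀ s, D s ⊆ G.avail s) :
    ∃ τ : G.Strategy P, τ.IsMemoryless ∧ ∀ s m, τ.allowed s m = D s := by
  choose p hp using fun s => PMF.exists_support_eq (hD s)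
  have hmem : ∀ s a, 0 < p s a ↔ a ∈ D s := fun s a => by
    rw [← hp, PMF.mem_support_iff, pos_iff_ne_zero]
  refine ⟨{ Mem := Unit, countable_mem := inferInstance, mem₀ := (), choose := fun s _ => p s,
            choose_avail := fun s _ a h => hsub s ((hmem s a).1 h), update := fun _ _ => () },
    inferInstanceAs (Subsingleton Unit), fun s m => ?_⟩
  ext a
  rw [Strategy.mem_allowed_iff]
  exact hmem s a

variable [Finite S] [Finite A]

theorem almostSureWinning_iff_measure {σ : G.SysStrategy} :
    G.AlmostSureWinning σ ↔
      ∀ τ : G.EnvStrategy, ∀ s₀ ∈ G.start, G.playMeasure σ τ s₀ G.winningRuns = 1 := by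
  simp only [AlmostSureWinning, cond_feasibleRuns]

/-- The environment may use memory: at system states it has no say, so the probability of `a` is a
fixed positive number. -/
theorem ae_frequently_eq_of_mem_allowed {σ : G.SysStrategy} (hσ : σ.IsMemoryless)
    (τ : G.EnvStrategy) (s₀ : S) :
    ∀ᵐ π ∂G.playMeasure σ τ s₀, ∀ s : G.sys, ∀ a ∈ σ.allowed s σ.mem₀,
      (s : S) ∈ infStates π → ∃ᶠ n in atTop, π n = ⟨s, a⟩ := by
  simp only [ae_all_iff]
  intro s a ha
  refine G.ae_frequently_eq_of_le_chooseAction σ τ s₀ s a (c := σ.choose s σ.mem₀ a) ha.1.ne' ?_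
  intro m m'
  simp [chooseAction, hσ.eq_mem₀ m]

theorem ae_frequently_eq_of_chooseAction_ne_zero {σ : G.SysStrategy} (hσ : σ.IsMemoryless)
    {τ : G.EnvStrategy} (hτ : τ.IsMemoryless) (s₀ : S) :
    ∀ᵐ π ∂G.playMeasure σ τ s₀, ∀ s a, G.chooseAction σ τ s σ.mem₀ τ.mem₀ a ≠ 0 →
      s ∈ infStates π → ∃ᶠ n in atTop, π n = ⟨s, a⟩ := by
  simp only [ae_all_iff]
  intro s a ha
  refine G.ae_frequently_eq_of_le_chooseAction σ τ s₀ s a ha fun m m' => ?_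
  rw [hσ.eq_mem₀ m, hτ.eq_mem₀ m']

theorem almostSureWinning_of_forall_not_isLosingWitness {σ : G.SysStrategy} (hσ : σ.IsMemoryless)
    (h : ∀ π, ¬ G.IsLosingWitness (fun s => σ.allowed s σ.mem₀) π) : G.AlmostSureWinning σ := by
  rw [almostSureWinning_iff_measure]
  intro τ s₀ hs₀
  have hae : ∀ᵐ π ∂G.playMeasure σ τ s₀, π ∈ G.winningRuns := by
    filter_upwards [G.ae_mem_feasibleRuns σ τ s₀, G.ae_mem_infStates_of_trans_pos σ τ s₀,
      ae_frequently_eq_of_mem_allowed hσ τ s₀] with π ⟨hrun, h0, hsys, _⟩ htrans hact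
    by_contra hlose
    refine h π ⟨hrun, h0 ▸ hs₀, fun n hn => ?_, hlose, htrans, hact⟩
    rw [Strategy.mem_allowed_iff, ← hσ.eq_mem₀ (σ.memAt (fun j => (π j).state) n)]
    exact hsys n hn
  exact (measure_congr (eventuallyEq_univ.2 hae)).trans measure_univ

/-- If, at the recurrent states of a losing witness, two memoryless strategies together enable
exactly its recurrent steps, then almost every play that enters these states has the same set of
recurrent states. -/
theorem IsLosingWitness.ae_infStates_eq {σ : G.SysStrategy} (hσ : σ.IsMemoryless)
    {τ : G.EnvStrategy} (hτ : τ.IsMemoryless) {act : G.sys → Set A} {π : ℕ → Step S A}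
    (hπ : G.IsLosingWitness act π)
    (hio : ∀ s a, s ∈ infStates π →
      (G.chooseAction σ τ s σ.mem₀ τ.mem₀ a ≠ 0 ↔ ∃ᶠ n in atTop, π n = ⟨s, a⟩))
    (s₀ : S) (N : ℕ) :
    ∀ᵐ ω ∂G.playMeasure σ τ s₀, (ω N).state ∈ infStates π → infStates ω = infStates π := by
  filter_upwards [G.ae_chooseAction_ne_zero σ τ s₀, G.ae_mem_infStates_of_trans_pos σ τ s₀,
    ae_frequently_eq_of_chooseAction_ne_zero hσ hτ s₀] with ω ⟨_, ht, hc⟩ htrans hact hN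
  refine infStates_eq_of_closed (eventually_atTop.2 ⟨N, fun n hn => ?_⟩) fun n hn hmem => ?_
  · induction n, hn using Nat.le_induction with
    | base => exact hN
    | succ n _ ih =>
      have h := hc n
      rw [hσ.eq_mem₀ (σ.memAt _ n), hτ.eq_mem₀ (τ.memAt _ n)] at h
      exact hπ.trans_closed _ _ _ ((hio _ _ ih).1 h) (pos_iff_ne_zero.2 (ht n))
  · exact htrans _ _ _
      (hact _ _ ((hio _ _ (mem_infStates_of_frequently hn)).2 hn) hmem) (hπ.isRun n).2

theorem IsLosingWitness.not_almostSureWinning {σ : G.SysStrategy} (hσ : σ.IsMemoryless)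
    {π : ℕ → Step S A} (hπ : G.IsLosingWitness (fun s => σ.allowed s σ.mem₀) π) :
    ¬ G.AlmostSureWinning σ := by
  classical
  rw [almostSureWinning_iff_measure]
  intro hwin
  have hio_avail : ∀ {s a}, (∃ᶠ n in atTop, π n = ⟨s, a⟩) → a ∈ G.avail s := by
    intro s a h
    obtain ⟨n, hn⟩ := h.exists
    have := (hπ.isRun n).1
    rwa [hn] at this
  -- At recurrent states of `π` the environment plays exactly the recurrent actions, which traps the
  -- play there; elsewhere it plays every available action, so that `π` can be followed to its
  -- recurrent states.
  obtain ⟨τ, hτ, hτD⟩ := exists_memoryless_allowed_eq (G := G) (P := G.env)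
    (fun s => {a | a ∈ G.avail s ∧ ((s : S) ∈ infStates π → ∃ᶠ n in atTop, π n = ⟨s, a⟩)})
    (fun s => by
      by_cases hs : (s : S) ∈ infStates π
      · obtain ⟨a, ha⟩ := exists_frequently_eq_of_mem_infStates hs
        exact ⟨a, hio_avail ha, fun _ => ha⟩
      · obtain ⟨a, ha⟩ := G.avail_nonempty s
        exact ⟨a, ha, fun h => absurd h hs⟩)
    (fun s a ha => ha.1)
  have hio : ∀ s a, s ∈ infStates π →
      (G.chooseAction σ τ s σ.mem₀ τ.mem₀ a ≠ 0 ↔ ∃ᶠ n in atTop, π n = ⟨s, a⟩) := by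
    intro s a hs
    by_cases hsys : s ∈ G.sys
    · rw [chooseAction_ne_zero_iff_of_mem σ τ hsys]
      refine ⟨fun ha => hπ.act_closed ⟨s, hsys⟩ a ha hs, fun h => ?_⟩
      obtain ⟨n, hn⟩ := h.exists
      have := hπ.mem_act n (by rwa [hn])
      simpa only [hn] using this
    · rw [chooseAction_ne_zero_iff_of_notMem σ τ hsys, hτD]
      exact ⟨fun h => h.2 hs, fun h => ⟨hio_avail h, fun _ => h⟩⟩
  have hout : ∀ n, (π n).state ∉ infStates π →
      G.chooseAction σ τ (π n).state σ.mem₀ τ.mem₀ (π n).action ≠ 0 := by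
    intro n hn
    by_cases hsys : (π n).state ∈ G.sys
    · exact (chooseAction_ne_zero_iff_of_mem σ τ hsys _ _ _).2 (hπ.mem_act n hsys)
    · rw [chooseAction_ne_zero_iff_of_notMem σ τ hsys, hτD]
      exact ⟨(hπ.isRun n).1, fun h => absurd h hn⟩
  have hex : ∃ n, (π n).state ∈ infStates π := by
    obtain ⟨s, hs⟩ := infStates_nonempty π
    obtain ⟨n, rfl⟩ := Frequently.exists hs
    exact ⟨n, hs⟩
  -- With the first entrance, all earlier states are non-recurrent, so `hout` covers every earlier
  -- step.
  let N := Nat.find hex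
  have hN : (π N).state ∈ infStates π := Nat.find_spec hex
  obtain ⟨a, ha⟩ := exists_frequently_eq_of_mem_infStates hN
  -- The step at the entrance to the recurrent states need not be recurrent itself.
  let π' : ℕ → Step S A := Function.update π N ⟨(π N).state, a⟩
  have hstate : ∀ n, (π' n).state = (π n).state := by
    intro n
    by_cases hn : n = N
    · subst hn; simp [π']
    · simp [π', hn]
  have hlt : ∀ n < N, π' n = π n := fun n hn => Function.update_of_ne hn.ne _ _
  have hpos := G.playMeasure_prefix_ne_zero σ τ (π := π') (N := N)
    (fun n hn => by rw [hstate (n + 1), hlt n hn]; exact (hπ.isRun n).2.ne')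
    (fun n hn => by
      rw [hσ.eq_mem₀ (σ.memAt _ n), hτ.eq_mem₀ (τ.memAt _ n)]
      rcases hn.lt_or_eq with hn | rfl
      · rw [hlt n hn]; exact hout n (Nat.find_min hex hn)
      · rw [hstate, hio _ _ hN]; simpa [π'] using ha) N le_rfl
  rw [hstate] at hpos
  -- An almost-everywhere inclusion suffices to bound the measure of the winning set, so only the
  -- cylinder has to be shown measurable.
  have hnull : ∀ᵐ ω ∂G.playMeasure σ τ (π 0).state,
      ω ∈ G.winningRuns → ω ∈ {ω | ∀ i ≤ N, ω i = π' i}ᶜ := by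
    filter_upwards [hπ.ae_infStates_eq hσ hτ hio (π 0).state N] with ω hω hω_win hpre
    have hmem : (ω N).state ∈ infStates π := by rwa [hpre N le_rfl, hstate]
    refine hπ.losing ?_
    rwa [winningRuns, Set.mem_ofPred_eq, hω hmem] at hω_win
  have hmeas : MeasurableSet {ω : ℕ → Step S A | ∀ i ≤ N, ω i = π' i} := by
    simp only [Set.ofPred_forall]
    exact .iInter fun i => .iInter fun _ =>
      measurable_pi_apply (X := fun _ => Step S A) i (MeasurableSet.of_discrete (s := {π' i}))
  have h1 : G.playMeasure σ τ (π 0).state G.winningRuns ≤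
      G.playMeasure σ τ (π 0).state {ω | ∀ i ≤ N, ω i = π' i}ᶜ := measure_mono_ae hnull
  rw [hwin τ _ hπ.start, prob_compl_eq_one_sub hmeas] at h1
  exact (ENNReal.sub_lt_self ENNReal.one_ne_top one_ne_zero hpos).not_ge h1

theorem almostSureWinning_iff_forall_not_isLosingWitness {σ : G.SysStrategy}
    (hσ : σ.IsMemoryless) :
    G.AlmostSureWinning σ ↔ ∀ π, ¬ G.IsLosingWitness (fun s => σ.allowed s σ.mem₀) π :=
  ⟨fun h _ hπ => hπ.not_almostSureWinning hσ h,
    almostSureWinning_of_forall_not_isLosingWitness hσ⟩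

end RabinGame

theorem lemma5 {S A : Type*} [Finite S] [Finite A] (G : RabinGame S A)
    (σ₁ σ₂ : G.SysStrategy) (h₁ : σ₁.IsMemoryless) (h₂ : σ₂.IsMemoryless)
    (hallowed : ∀ s : G.sys, σ₁.allowed s σ₁.mem₀ = σ₂.allowed s σ₂.mem₀) :
    G.AlmostSureWinning σ₁ ↔ G.AlmostSureWinning σ₂ := by
  rw [RabinGame.almostSureWinning_iff_forall_not_isLosingWitness h₁,
    RabinGame.almostSureWinning_iff_forall_not_isLosingWitness h₂, funext hallowed]
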